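/- Let $R$ be an associative ring with unit; modules are unitary left $R$-modules. A module $M$ is \emph{algebraically compact} if, for every infinite cardinal $\kappa$, every system of linear equations $\sum_{j\in J} r_{ij}x_j=m_i$ ($i\in I$) with $|I|,|J|\le\kappa$, $r_{ij}\in R$, $m_i\in M$, and, for each $i$, $r_{ij}=0$ for almost all $j$, has a solution in $M$ whenever each of its finite subsystems has a solution in $M$. A submodule $N\subseteq M$ is \emph{pure} if every finite system of linear equations with constants in $N$ that is solvable in $M$ is solvable in $N$; an exact sequence $0\to N\to M\to C\to 0$ is \emph{pure exact} if the image of $N$ is pure in $M$. A module is \emph{pure projective} if it has the lifting property with respect to all pure exact sequences. The \emph{pure projective dimension} of a module $X$ is the least $n$ for which there is an exact sequence $0\to P_n\to\cdots\to P_0\to X\to 0$ with all $P_i$ pure projective that is a splice of pure exact sequences ($\infty$ if there is none), and the \emph{pure global dimension} of $R$ is the supremum of the pure projective dimensions of all $R$-modules. Assume that the pure global dimension of $R$ is at most $1$, let $A$ be an arbitrary (for instance infinite) index set, and let $(M_\alpha)_{\alpha\in A}$ be a family of $R$-modules. If every $M_\alpha$ is algebraically compact, then the quotient module $\prod_{\alpha\in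 A}M_\alpha\big/\bigoplus_{\alpha\in A}M_\alpha$ is algebraically compact. -/

import Mathlib

/-- A linear system over the left `R`-module `M`, with equations indexed by `I` and unknowns
indexed by `J`: the `i`-th equation is `∑ j, r i j • x j = m i`, where almost all coefficients
`r i j` (for fixed `i`) vanish. `SolvesEquation r m x i` says that the assignment `x` satisfies the
`i`-th equation. -/
def SolvesEquation {R M I J : Type*} [Ring R] [AddCommGroup M] [Module R M]
    (r : I → J →₀ R) (m : I → M) (x : J → M) (i : I) : Prop :=
  ((r i).sum fun j a => a • x j) = m i

/-- `M` is `κ`-compact: every system of at most `κ` linear equations in at most `κ` unknowns over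
`M` has a solution in `M` whenever all of its finite subsystems have solutions in `M`. -/
def IsKappaCompact.{u, w} (R : Type u) [Ring R] (κ : Cardinal.{w})
    (M : Type w) [AddCommGroup M] [Module R M] : Prop :=
  ∀ (I J : Type w), Cardinal.mk I ≤ κ → Cardinal.mk J ≤ κ →
    ∀ (r : I → J →₀ R) (m : I → M),
      (∀ s : Finset I, ∃ x : J → M, ∀ i ∈ s, SolvesEquation r m x i) →
      ∃ x : J → M, ∀ i, SolvesEquation r m x i

/-- `M` is algebraically compact: it is `κ`-compact for every infinite cardinal `κ`. -/
def IsAlgebraicallyCompact.{u, w} (R : Type u) [Ring R]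
    (M : Type w) [AddCommGroup M] [Module R M] : Prop :=
  ∀ κ : Cardinal.{w}, Cardinal.aleph0 ≤ κ → IsKappaCompact R κ M

/-- `N` is a pure submodule of `M`: every finite system of linear equations with constants in `N`
that is solvable in `M` is solvable in `N`. -/
def IsPureSubmodule {R M : Type*} [Ring R] [AddCommGroup M] [Module R M]
    (N : Submodule R M) : Prop :=
  ∀ (k l : ℕ) (r : Matrix (Fin k) (Fin l) R) (c : Fin k → N),
    (∃ x : Fin l → M, ∀ i, ∑ j, r i j • x j = (c i : M)) →
    ∃ y : Fin l → N, ∀ i, ∑ j, r i j • y j = c i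

/-- `g : B → C` is a pure epimorphism: `0 → ker g → B → C → 0` is a pure exact sequence. -/
def IsPureEpi {R B C : Type*} [Ring R] [AddCommGroup B] [Module R B]
    [AddCommGroup C] [Module R C] (g : B →ₗ[R] C) : Prop :=
  Function.Surjective g ∧ IsPureSubmodule (LinearMap.ker g)

/-- `P` is pure projective: it has the lifting property with respect to all pure exact sequences
`0 → A → B → C → 0`. -/
def IsPureProjective.{u, w} (R : Type u) [Ring R]
    (P : Type w) [AddCommGroup P] [Module R P] : Prop :=
  ∀ (B C : Type w) [AddCommGroup B] [Module R B] [AddCommGroup C] [Module R C]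
    (g : B →ₗ[R] C), IsPureEpi g → ∀ f : P →ₗ[R] C, ∃ h : P →ₗ[R] B, g ∘ₗ h = f

/-- `X` has a pure projective resolution of length `n`, that is, a pure exact sequence
`0 → P n → ⋯ → P 1 → P 0 → X → 0` with all `P i` pure projective. -/
def HasPureProjectiveResolution.{u, w} (R : Type u) [Ring R] :
    ℕ → ∀ (X : Type w) [AddCommGroup X] [Module R X], Prop
  | 0, X, _, _ => IsPureProjective R X
  | n + 1, X, _, _ => ∃ P : ModuleCat.{w} R, ∃ g : P →ₗ[R] X,
      IsPureProjective R P ∧ IsPureEpi g ∧ HasPureProjectiveResolution R n (LinearMap.ker g)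

/-- The pure projective dimension of `X`: the least length of a pure projective resolution, and
`⊤` if there is no finite one. -/
noncomputable def pureProjectiveDimension.{u, w} (R : Type u) [Ring R]
    (X : Type w) [AddCommGroup X] [Module R X] : ℕ∞ :=
  ⨅ (n : ℕ) (_ : HasPureProjectiveResolution R n X), (n : ℕ∞)

/-- The (left) pure global dimension of `R`: the supremum of the pure projective dimensions of the
left `R`-modules (in the universe `w`). -/
noncomputable def pureGlobalDimension.{u, w} (R : Type u) [Ring R] : ℕ∞ :=
  ⨆ X : ModuleCat.{w} R, pureProjectiveDimension R X

/-- The direct sum `⨁ a, M a`, as a submodule of the product `∀ a, M a`. -/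
def directSumInProduct (R : Type*) [Ring R] {A : Type*} (M : A → Type*)
    [∀ a, AddCommGroup (M a)] [∀ a, Module R (M a)] : Submodule R (∀ a, M a) :=
  LinearMap.range (DirectSum.coeFnLinearMap R : (DirectSum A M) →ₗ[R] ∀ a, M a)

universe u v

section PureSubmodules

variable {R : Type*} [Ring R]

/-! The direct sum is pure in the product, and the product is algebraically compact, so the quotient
`Q` is a pure quotient of an algebraically compact `M`. As `M` is pure injective, Pext¹(-, M) = 0;
pure global dimension at most 1 gives Pext² = 0, hence Pext¹(-, Q) = 0.
`exists_retraction_of_pureEpi` carries this out by hand. Finally, a finitely solvable system over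
`Q` yields a pure embedding of `Q` into a pushout, and a retraction of it is a solution. -/

theorem IsPureSubmodule.exists_solution {M I J : Type*} [AddCommGroup M] [Module R M]
    {N : Submodule R M} (hN : IsPureSubmodule N) (r : I → J →₀ R) (c : I → N) (s : Finset I)
    (h : ∃ x : J → M, ∀ i ∈ s, SolvesEquation r (fun i => (c i : M)) x i) :
    ∃ y : J → N, ∀ i ∈ s, SolvesEquation r c y i := by
  classical
  obtain ⟨x, hx⟩ := h
  let t : Finset J := s.biUnion fun i => (r i).support
  have ht : ∀ i ∈ s, (r i).support ⊆ t := fun i hi =>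
    Finset.subset_biUnion_of_mem (fun i => (r i).support) hi
  let es := s.equivFin
  let et := t.equivFin
  obtain ⟨y, hy⟩ := hN s.card t.card (fun a b => r (es.symm a) (et.symm b))
    (fun a => c (es.symm a)) ⟨fun b => x (et.symm b), fun a => by
      refine Eq.trans ?_ (hx _ (es.symm a).2)
      rw [Finsupp.sum_of_support_subset _ (ht _ (es.symm a).2) _ (by simp),
        ← Finset.sum_coe_sort t]
      exact et.symm.sum_comp fun j : t => r (es.symm a) j • x j⟩
  refine ⟨fun j => if h : j ∈ t then y (et ⟨j, h⟩) else 0, fun i hi => ?_⟩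
  have := hy (es ⟨i, hi⟩)
  simp only [Equiv.symm_apply_apply] at this
  rw [SolvesEquation, ← this, Finsupp.sum_of_support_subset _ (ht i hi) _ (by simp),
    ← Finset.sum_coe_sort t, ← et.sum_comp]
  exact Finset.sum_congr rfl fun j _ => by simp

/-- Finitely many constants have a common finite support; a solution truncated to it still solves
the system. -/
theorem isPureSubmodule_directSumInProduct {A : Type*} (M : A → Type*)
    [∀ a, AddCommGroup (M a)] [∀ a, Module R (M a)] :
    IsPureSubmodule (directSumInProduct R M) := by
  classical
  rintro k l r c ⟨x, hx⟩
  choose d hd using fun i => (c i).2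
  let T : Finset A := Finset.univ.biUnion fun i => DFinsupp.support (d i)
  have hT : ∀ a ∉ T, ∀ i, (c i : ∀ a, M a) a = 0 := by
    intro a ha i
    rw [← hd i]
    by_contra h
    exact ha (Finset.mem_biUnion.2 ⟨i, Finset.mem_univ _, DFinsupp.mem_support_iff.2 h⟩)
  refine ⟨fun j => ⟨fun a => if a ∈ T then x j a else 0,
    DFinsupp.mk T fun a => x j a, ?_⟩, fun i => ?_⟩
  · ext a
    change (DFinsupp.mk T fun a => x j a) a = _
    simp [DFinsupp.mk_apply]
  · ext a
    by_cases ha : a ∈ T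
    · simpa [ha] using congrFun (hx i) a
    · simp [ha, hT a ha i]

theorem isPureEpi_mkQ {M : Type*} [AddCommGroup M] [Module R M] {N : Submodule R M}
    (hN : IsPureSubmodule N) : IsPureEpi N.mkQ :=
  ⟨N.mkQ_surjective, by rwa [Submodule.ker_mkQ]⟩

end PureSubmodules

section AlgebraicCompactness

universe w

variable {R : Type u} [Ring R]

theorem IsAlgebraicallyCompact.exists_solution {M : Type w} [AddCommGroup M] [Module R M]
    (hM : IsAlgebraicallyCompact R M) {I J : Type w} (r : I → J →₀ R) (m : I → M)
    (h : ∀ s : Finset I, ∃ x : J → M, ∀ i ∈ s, SolvesEquation r m x i) :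
    ∃ x : J → M, ∀ i, SolvesEquation r m x i :=
  hM (max Cardinal.aleph0 (max (Cardinal.mk I) (Cardinal.mk J))) (le_max_left _ _) I J
    ((le_max_left _ _).trans (le_max_right _ _)) ((le_max_right _ _).trans (le_max_right _ _))
    r m h

theorem solvesEquation_pi_iff {A I J : Type*} {M : A → Type*} [∀ a, AddCommGroup (M a)]
    [∀ a, Module R (M a)] {r : I → J →₀ R} {m : I → ∀ a, M a} {x : J → ∀ a, M a} {i : I} :
    SolvesEquation r m x i ↔
      ∀ a, SolvesEquation r (fun i => m i a) (fun j => x j a) i := by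
  simp [SolvesEquation, Finsupp.sum, funext_iff]

theorem IsAlgebraicallyCompact.pi {A : Type w} {M : A → Type w} [∀ a, AddCommGroup (M a)]
    [∀ a, Module R (M a)] (hM : ∀ a, IsAlgebraicallyCompact R (M a)) :
    IsAlgebraicallyCompact R (∀ a, M a) := by
  intro κ hκ I J hI hJ r m h
  have (a : A) : ∃ x : J → M a, ∀ i, SolvesEquation r (fun i => m i a) x i :=
    hM a κ hκ I J hI hJ r _ fun s =>
      let ⟨x, hx⟩ := h s
      ⟨fun j => x j a, fun i hi => solvesEquation_pi_iff.1 (hx i hi) a⟩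
  choose x hx using this
  exact ⟨fun j a => x a j, fun i => solvesEquation_pi_iff.2 fun a => hx a i⟩

end AlgebraicCompactness

section PureInjectivity

variable {R : Type u} [Ring R]

/-- Algebraically compact modules are pure injective. -/
theorem IsAlgebraicallyCompact.exists_extension {M B : Type max u v}
    [AddCommGroup M] [Module R M] [AddCommGroup B] [Module R B]
    (hM : IsAlgebraicallyCompact R M) {N : Submodule R B} (hN : IsPureSubmodule N)
    (f : N →ₗ[R] M) : ∃ g : B →ₗ[R] M, g ∘ₗ N.subtype = f := by
  -- One unknown per element of `B`, one equation per formal combination with value in `N`.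
  -- Combinations with value 0 force a solution to be linear.
  let I : Type max u v := N.comap (Finsupp.linearCombination R (id : B → B))
  let r : I → B →₀ R := fun i => i.1
  let c : I → N := fun i => ⟨Finsupp.linearCombination R id i.1, i.2⟩
  obtain ⟨x, hx⟩ := hM.exists_solution r (fun i => f (c i)) fun s => by
    obtain ⟨y, hy⟩ := hN.exists_solution r c s
      ⟨id, fun i _ => (Finsupp.linearCombination_apply R i.1).symm⟩
    refine ⟨fun b => f (y b), fun i hi => ?_⟩
    have := congrArg f (hy i hi)
    simpa [SolvesEquation, Finsupp.sum, map_sum] using this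
  have key (p : B →₀ R) (hp : Finsupp.linearCombination R id p ∈ N) :
      Finsupp.linearCombination R x p = f ⟨_, hp⟩ := by
    rw [Finsupp.linearCombination_apply]
    exact hx ⟨p, hp⟩
  have key_zero (p : B →₀ R) (hp : Finsupp.linearCombination R id p = 0) :
      Finsupp.linearCombination R x p = 0 := by
    rw [key p (hp ▸ N.zero_mem), ← map_zero f]
    exact congrArg f (Subtype.ext hp)
  refine ⟨{ toFun := x, map_add' := fun a b => ?_, map_smul' := fun a b => ?_ }, ?_⟩
  · have := key_zero (Finsupp.single (a + b) 1 - Finsupp.single a 1 - Finsupp.single b 1)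
      (by simp)
    simpa [sub_sub, sub_eq_zero] using this
  · have := key_zero (Finsupp.single (a • b) 1 - Finsupp.single b a) (by simp)
    simpa [sub_eq_zero] using this
  · ext n
    have := key (Finsupp.single (n : B) 1) (by simp)
    simpa using this

end PureInjectivity

section PureGlobalDimension

universe w

variable {R : Type u} [Ring R]

theorem isPureProjective_of_subsingleton (P : Type w) [AddCommGroup P] [Module R P]
    [Subsingleton P] : IsPureProjective R P :=
  fun _ _ _ _ _ _ _ _ _ => ⟨0, LinearMap.ext fun p => by simp [Subsingleton.elim p 0]⟩

theorem isPureEpi_id (X : Type*) [AddCommGroup X] [Module R X] :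
    IsPureEpi (LinearMap.id : X →ₗ[R] X) := by
  refine ⟨Function.surjective_id, ?_⟩
  rintro k l r c -
  exact ⟨0, fun i => Subtype.ext (by
    have h : (c i : X) = 0 := LinearMap.mem_ker.1 (c i).2
    rw [h, Submodule.coe_eq_zero]
    exact Finset.sum_eq_zero fun _ _ => smul_zero _)⟩

theorem exists_pureEpi_of_pureGlobalDimension_le_one
    (hR : pureGlobalDimension.{u, w} R ≤ 1) (X : Type w) [AddCommGroup X] [Module R X] :
    ∃ P : ModuleCat.{w} R, ∃ g : P →ₗ[R] X,
      IsPureProjective R P ∧ IsPureEpi g ∧ IsPureProjective R (LinearMap.ker g) := by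
  have hX : pureProjectiveDimension R X < 2 :=
    ((le_iSup (fun X : ModuleCat.{w} R => pureProjectiveDimension R X)
      (ModuleCat.of R X)).trans hR).trans_lt (by norm_num)
  simp only [pureProjectiveDimension, iInf_lt_iff] at hX
  obtain ⟨n, h, hn⟩ := hX
  have hn : n < 2 := by exact_mod_cast hn
  interval_cases n
  · have : Subsingleton (LinearMap.ker (LinearMap.id : X →ₗ[R] X)) := by
      rw [LinearMap.ker_id]
      infer_instance
    -- Length 0 is padded to length 1 by a zero kernel.
    exact ⟨ModuleCat.of R X, LinearMap.id, h, isPureEpi_id X, isPureProjective_of_subsingleton _⟩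
  · exact h

end PureGlobalDimension

section PureExtensions

variable {R : Type u} [Ring R]

/-- If the pure global dimension is at most one, a pure monomorphism into `X` splits as soon as
its source is a pure quotient of an algebraically compact module. -/
theorem exists_retraction_of_pureEpi (hR : pureGlobalDimension.{u, max u v} R ≤ 1)
    {M Q X : Type max u v} [AddCommGroup M] [Module R M] [AddCommGroup Q] [Module R Q]
    [AddCommGroup X] [Module R X] (hM : IsAlgebraicallyCompact R M)
    {p : M →ₗ[R] Q} (hp : IsPureEpi p) {i : Q →ₗ[R] X} (hi : Function.Injective i)
    (hiX : IsPureSubmodule (LinearMap.range i)) : ∃ s : X →ₗ[R] Q, s ∘ₗ i = LinearMap.id := by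
  obtain ⟨P, g, hP, hg, hK⟩ :=
    exists_pureEpi_of_pureGlobalDimension_le_one hR (X ⧸ LinearMap.range i)
  obtain ⟨h, hh⟩ := hP _ _ _ (isPureEpi_mkQ hiX) g
  have hrange (k : LinearMap.ker g) : h k ∈ LinearMap.range i := by
    refine (Submodule.Quotient.mk_eq_zero _).1 ((LinearMap.congr_fun hh k.1).trans ?_)
    exact k.2
  let e := LinearEquiv.ofInjective i hi
  let q : LinearMap.ker g →ₗ[R] Q :=
    e.symm ∘ₗ (h ∘ₗ (LinearMap.ker g).subtype).codRestrict (LinearMap.range i) hrange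
  have hq (k : LinearMap.ker g) : i (q k) = h k :=
    congrArg Subtype.val (e.apply_symm_apply ⟨h k, hrange k⟩)
  -- The obstruction `q` lifts to `M` since the kernel is pure projective, then extends to `P` since
  -- `M` is pure injective. Subtracting the extension makes `h` descend to a section `σ`.
  obtain ⟨l, hl⟩ := hK _ _ _ hp q
  obtain ⟨l', hl'⟩ := IsAlgebraicallyCompact.exists_extension.{u, v} hM hg.2 l
  let h' : P →ₗ[R] X := h - i ∘ₗ p ∘ₗ l'
  have hker : LinearMap.ker g ≤ LinearMap.ker h' := by
    intro k hk
    have h1 : l' k = l ⟨k, hk⟩ := LinearMap.congr_fun hl' ⟨k, hk⟩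
    have h2 : p (l ⟨k, hk⟩) = q ⟨k, hk⟩ := LinearMap.congr_fun hl ⟨k, hk⟩
    simp [h', h1, h2, hq]
  let σ : X ⧸ LinearMap.range i →ₗ[R] X :=
    (LinearMap.ker g).liftQ h' hker ∘ₗ (g.quotKerEquivOfSurjective hg.1).symm
  have hσg (y : P) : σ (g y) = h' y := by
    have : (g.quotKerEquivOfSurjective hg.1).symm (g y) = Submodule.Quotient.mk y := by
      rw [LinearEquiv.symm_apply_eq]
      rfl
    change (LinearMap.ker g).liftQ h' hker ((g.quotKerEquivOfSurjective hg.1).symm (g y)) = _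
    rw [this]
    rfl
  have hσ (c : X ⧸ LinearMap.range i) : (LinearMap.range i).mkQ (σ c) = c := by
    obtain ⟨y, rfl⟩ := hg.1 c
    have h1 : (LinearMap.range i).mkQ (h y) = g y := LinearMap.congr_fun hh y
    have h2 : (LinearMap.range i).mkQ (i (p (l' y))) = 0 := by simp
    rw [hσg]
    simp only [h', LinearMap.sub_apply, LinearMap.comp_apply, map_sub, h1, h2, sub_zero]
  have hτ (x : X) : x - σ ((LinearMap.range i).mkQ x) ∈ LinearMap.range i := by
    refine (Submodule.Quotient.mk_eq_zero _).1 ?_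
    rw [← Submodule.mkQ_apply, map_sub, hσ, sub_self]
  refine ⟨e.symm ∘ₗ (LinearMap.id - σ ∘ₗ (LinearMap.range i).mkQ).codRestrict _ hτ, ?_⟩
  ext a
  apply hi
  have h0 : (LinearMap.range i).mkQ (i a) = 0 := by simp
  refine (congrArg Subtype.val (e.apply_symm_apply
    ⟨i a - σ ((LinearMap.range i).mkQ (i a)), hτ _⟩)).trans ?_
  simp only [h0, map_zero, sub_zero, LinearMap.id_apply]

/-- If the pure global dimension is at most one, pure quotients of algebraically compact modules
are algebraically compact. -/
theorem IsAlgebraicallyCompact.of_pureEpi (hR : pureGlobalDimension.{u, max u v} R ≤ 1)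
    {M Q : Type max u v} [AddCommGroup M] [Module R M] [AddCommGroup Q] [Module R Q]
    (hM : IsAlgebraicallyCompact R M) {p : M →ₗ[R] Q} (hp : IsPureEpi p) :
    IsAlgebraicallyCompact R Q := by
  classical
  intro κ _ I J _ _ r m hfin
  let ρ : (I →₀ R) →ₗ[R] (J →₀ R) := Finsupp.linearCombination R r
  let φ : (I →₀ R) →ₗ[R] Q := Finsupp.linearCombination R m
  -- A solution of the whole system is a factorization of `φ` through `ρ`; finite solvability gives
  -- one on each finite set of equations.
  have hψ (s : Finset I) : ∃ ψ : (J →₀ R) →ₗ[R] Q,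
      ∀ a : I →₀ R, a.support ⊆ s → ψ (ρ a) = φ a := by
    obtain ⟨x, hx⟩ := hfin s
    refine ⟨Finsupp.linearCombination R x, fun a ha => ?_⟩
    simp only [ρ, φ, Finsupp.linearCombination_apply R a, Finsupp.sum, map_sum, map_smul]
    refine Finset.sum_congr rfl fun i hi => ?_
    rw [Finsupp.linearCombination_apply, show _ = m i from hx i (ha hi)]
  -- The pushout of `ρ` and `φ`.
  let W : Submodule R (Q × (J →₀ R)) := LinearMap.range ((-φ).prod ρ)
  let i : Q →ₗ[R] (Q × (J →₀ R)) ⧸ W := W.mkQ ∘ₗ LinearMap.inl R Q (J →₀ R)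
  have hi : Function.Injective i := by
    rw [injective_iff_map_eq_zero]
    intro q hq
    obtain ⟨a, ha⟩ := (Submodule.Quotient.mk_eq_zero W).1 hq
    obtain ⟨ψ, hψ⟩ := hψ a.support
    have h1 : -φ a = q := congrArg Prod.fst ha
    have h2 : ρ a = 0 := congrArg Prod.snd ha
    rw [← h1, ← hψ a subset_rfl, h2, map_zero, neg_zero]
  have hpure : IsPureSubmodule (LinearMap.range i) := by
    rintro k l b c ⟨x, hx⟩
    choose d hd using fun t => (c t).2
    choose z hz using fun j => W.mkQ_surjective (x j)
    have hmem (t : Fin k) : ∑ j, b t j • z j - (d t, 0) ∈ W := by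
      rw [← W.ker_mkQ, LinearMap.mem_ker, map_sub, map_sum, sub_eq_zero]
      simp only [map_smul, hz, hx, ← hd]
      rfl
    choose a ha using hmem
    -- Only finitely many relations of the pushout are involved, so this `ψ` carries the solution
    -- back to `Q`.
    obtain ⟨ψ, hψ⟩ := hψ (Finset.univ.biUnion fun t => (a t).support)
    refine ⟨fun j => ⟨i ((z j).1 + ψ (z j).2), LinearMap.mem_range_self _ _⟩, fun t => ?_⟩
    have h1 : -φ (a t) = ∑ j, b t j • (z j).1 - d t := by
      simpa [Prod.fst_sum] using congrArg Prod.fst (ha t)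
    have h2 : ρ (a t) = ∑ j, b t j • (z j).2 := by
      simpa [Prod.snd_sum] using congrArg Prod.snd (ha t)
    have h3 : ψ (ρ (a t)) = φ (a t) :=
      hψ _ (Finset.subset_biUnion_of_mem (fun t => (a t).support) (Finset.mem_univ t))
    have h4 : ∑ j, b t j • ((z j).1 + ψ (z j).2) = d t := by
      have h5 : ∑ j, b t j • ψ (z j).2 = φ (a t) := by
        rw [← h3, h2]
        simp
      simp only [smul_add, Finset.sum_add_distrib, h5]
      rw [← sub_eq_zero, add_sub_right_comm, ← h1, neg_add_cancel]
    apply Subtype.ext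
    rw [← hd t, ← h4]
    simp
  obtain ⟨s, hs⟩ := exists_retraction_of_pureEpi.{u, v} hR hM hp hi hpure
  let ψ : (J →₀ R) →ₗ[R] Q := s ∘ₗ W.mkQ ∘ₗ LinearMap.inr R Q (J →₀ R)
  refine ⟨fun j => ψ (Finsupp.single j 1), fun t => ?_⟩
  have h1 : ((r t).sum fun j a => a • ψ (Finsupp.single j 1)) = ψ (r t) := by
    conv_rhs => rw [← Finsupp.sum_single (r t)]
    simp only [Finsupp.sum, map_sum, ← map_smul, Finsupp.smul_single, smul_eq_mul, mul_one]
  have h2 : W.mkQ (0, r t) = i (m t) := by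
    rw [← sub_eq_zero]
    change W.mkQ _ - W.mkQ (m t, 0) = 0
    rw [← map_sub]
    refine (Submodule.Quotient.mk_eq_zero W).2 ⟨Finsupp.single t 1, ?_⟩
    simp [φ, ρ]
  rw [SolvesEquation, h1]
  change s (W.mkQ (0, r t)) = m t
  rw [h2]
  exact LinearMap.congr_fun hs (m t)

end PureExtensions

theorem proposition3 (R : Type u) [Ring R]
    (hR : pureGlobalDimension.{u, max u v} R ≤ 1)
    (A : Type (max u v)) (M : A → Type (max u v))
    [∀ a, AddCommGroup (M a)] [∀ a, Module R (M a)]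
    (hM : ∀ a, IsAlgebraicallyCompact R (M a)) :
    IsAlgebraicallyCompact R ((∀ a, M a) ⧸ directSumInProduct R M) :=
  (IsAlgebraicallyCompact.pi hM).of_pureEpi.{u, v} hR
    (isPureEpi_mkQ (isPureSubmodule_directSumInProduct M))
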